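/- Let $k,m,N\ge 0$ be integers, $n=k+m$, and let $$A=\begin{bmatrix}A_{11}&A_{12}\\A_{21}&A_{22}\end{bmatrix}\in\mathbb R^{n\times n},\qquad B=\begin{bmatrix}0\\B_2\end{bmatrix}\in\mathbb R^{n\times m},\qquad A_{11}\in\mathbb R^{k\times k},\ A_{22},B_2\in\mathbb R^{m\times m},\ \det B_2\ne 0,$$ with $(A,B)$ stabilizable, i.e. there is a real matrix $G$ such that all eigenvalues of $A-BG$ have negative real part. Let $F=B_2^{-1}V^{-1}\Sigma V[K\ \ I]$ with $V\in\mathbb R^{m\times m}$ invertible, $K\in\mathbb R^{m\times k}$, $\Sigma=\mathrm{diag}(\sigma_1,\dots,\sigma_m)$, all $\sigma_j>0$, be such that, for some $Q=Q^{\mathsf T}\ge 0$ and $R=R^{\mathsf T}>0$, the feedback $w=-Fz$ minimizes $\int_0^\infty (z^{\mathsf T}Qz+w^{\mathsf T}Rw)\,dt$ subject to $\dot z=Az+Bw$, $z(0)=z_0$, for every initial state $z_0$. Let $s_1,\dots,s_k\in\mathbb C$ be the eigenvalues (with multiplicity) of $A_{11}-A_{12}K$, and suppose that $\mathrm{Re}\,s_j<0$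 and that $s_j$ is not an eigenvalue of $A_{11}$, for every $j$. For real $d=(d_1,\dots,d_N)$ and a matrix $\mathcal A=[a_{ij}]\in\mathbb R^{N\times N}$ with $a_{ij}\ge 0$ and $a_{ii}=0$ put $\mathcal M=\mathrm{diag}(d_1,\dots,d_N)-\mathcal A$ and $r_i=\sum_{j=1}^N a_{ij}$. Call $(d,\mathcal A)$ separated if there is an ordering $\kappa_1,\dots,\kappa_N$ of $\{1,\dots,N\}$ with $$d_{\kappa_1}>r_{\kappa_1},\qquad d_{\kappa_{i+1}}-d_{\kappa_i}>r_{\kappa_{i+1}}+r_{\kappa_i}\quad(i=1,\dots,N-1).$$ (a) If $(d,\mathcal A)$ is separated, then $\mathcal M$ is diagonalizable over $\mathbb R$: there are an invertible real matrix $T$ and pairwise distinct positive reals $p_1,\dots,p_N$ with $T\mathcal M T^{-1}=\mathrm{diag}(p_1,\dots,p_N)$. (b) Let $d_i\to\infty$ for all $i=1,\dots,N$, while $(d,\mathcal A)$ stays separated and $\mathcal A$ is fixed (or, more generally, varies with its entries bounded; it need not tend to $0$). Then the $nN$ eigenvalues, counted with algebraic multiplicity, of the matrix $$(I_N\otimes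 A)-(I_N\otimes B)(\mathcal M\otimes I_m)(I_N\otimes F)$$ can be labelled $\lambda_i^j$, $i=1,\dots,N$, $j=1,\dots,n$, so that (i) $\lambda_i^j\to s_j$ for $j=1,\dots,k$ and all $i$; (ii) $\lambda_i^{k+j}$ is asymptotic to $-d_i\sigma_j$ for $j=1,\dots,m$ and all $i$, that is, $\lambda_i^{k+j}/(-d_i\sigma_j)\to 1$, and moreover $\lambda_i^{k+j}+d_i\sigma_j$ stays bounded. -/

import Mathlib

open scoped Kronecker Matrix
open Filter Topology Asymptotics MeasureTheory

namespace MAS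

/-- The complex eigenvalues of a real square matrix, with algebraic multiplicity. -/
noncomputable def eigenvalues {ν : Type*} [Fintype ν] [DecidableEq ν]
    (X : Matrix ν ν ℝ) : Multiset ℂ :=
  (X.map Complex.ofReal).charpoly.roots

/-- All eigenvalues lie in the open left half plane. -/
def IsHurwitz {ν : Type*} [Fintype ν] [DecidableEq ν] (X : Matrix ν ν ℝ) : Prop :=
  ∀ z ∈ eigenvalues X, z.re < 0

/-- The pair `(A, B)` is stabilizable. -/
def IsStabilizable {ν μ : Type*} [Fintype ν] [DecidableEq ν] [Fintype μ]
    (A : Matrix ν ν ℝ) (B : Matrix ν μ ℝ) : Prop :=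
  ∃ G : Matrix μ ν ℝ, IsHurwitz (A - B * G)

/-- `z` solves `ż = A z + B w` on `[0, ∞)` (in integrated form), `z 0 = z₀`, where the control `w`
is locally integrable. -/
structure IsTrajectory {ν μ : Type*} [Fintype ν] [Fintype μ]
    (A : Matrix ν ν ℝ) (B : Matrix ν μ ℝ) (z₀ : ν → ℝ) (z : ℝ → ν → ℝ) (w : ℝ → μ → ℝ) :
    Prop where
  continuousOn : ContinuousOn z (Set.Ici 0)
  locallyIntegrable : ∀ t : ℝ, 0 ≤ t → IntervalIntegrable w volume 0 t
  eq_integral : ∀ t : ℝ, 0 ≤ t → z t = z₀ + ∫ τ in (0 : ℝ)..t, (A *ᵥ z τ + B *ᵥ w τ)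

/-- The quadratic cost `∫₀^∞ (zᵀ Q z + wᵀ R w) dt`, with values in `[0, ∞]`
(the integrand is nonnegative for `Q ≥ 0`, `R > 0`). -/
noncomputable def lqrCost {ν μ : Type*} [Fintype ν] [Fintype μ]
    (Q : Matrix ν ν ℝ) (R : Matrix μ μ ℝ) (z : ℝ → ν → ℝ) (w : ℝ → μ → ℝ) : ENNReal :=
  ∫⁻ t in Set.Ioi (0 : ℝ), ENNReal.ofReal (z t ⬝ᵥ (Q *ᵥ z t) + w t ⬝ᵥ (R *ᵥ w t))

/-- The feedback `w = -F z` solves the LQR problem: from every initial state, the closed-loop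
trajectory has the least cost among all trajectories. -/
def IsLQRSolution {ν μ : Type*} [Fintype ν] [Fintype μ]
    (A : Matrix ν ν ℝ) (B : Matrix ν μ ℝ) (Q : Matrix ν ν ℝ) (R : Matrix μ μ ℝ)
    (F : Matrix μ ν ℝ) : Prop :=
  ∀ (z₀ : ν → ℝ) (z : ℝ → ν → ℝ), IsTrajectory A B z₀ z (fun t => -(F *ᵥ z t)) →
    ∀ (z' : ℝ → ν → ℝ) (w' : ℝ → μ → ℝ), IsTrajectory A B z₀ z' w' →
      lqrCost Q R z (fun t => -(F *ᵥ z t)) ≤ lqrCost Q R z' w'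

/-- Coupling weights: nonnegative, with zero diagonal. -/
def IsCoupling {N : ℕ} (a : Matrix (Fin N) (Fin N) ℝ) : Prop :=
  (∀ i j, 0 ≤ a i j) ∧ ∀ i, a i i = 0

/-- The matrix `𝓜 = 𝓓 - 𝓐`, with `𝓓 = diag(d)`. -/
def couplingM {N : ℕ} (d : Fin N → ℝ) (a : Matrix (Fin N) (Fin N) ℝ) :
    Matrix (Fin N) (Fin N) ℝ :=
  Matrix.diagonal d - a

/-- The row sum `r i = ∑ j, a i j`. -/
def rowSum {N : ℕ} (a : Matrix (Fin N) (Fin N) ℝ) (i : Fin N) : ℝ := ∑ j, a i j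

/-- For some ordering `κ` of the agents, `d_{κ 1} > r_{κ 1}` and
`d_{κ (i+1)} - d_{κ i} > r_{κ (i+1)} + r_{κ i}` for all consecutive positions. -/
def GershgorinSeparated {N : ℕ} (d : Fin N → ℝ) (a : Matrix (Fin N) (Fin N) ℝ) : Prop :=
  ∃ κ : Equiv.Perm (Fin N),
    (∀ i : Fin N, (i : ℕ) = 0 → rowSum a (κ i) < d (κ i)) ∧
    ∀ i j : Fin N, (j : ℕ) = (i : ℕ) + 1 →
      rowSum a (κ j) + rowSum a (κ i) < d (κ j) - d (κ i)

/-- The system matrix `(I ⊗ A) - (I ⊗ B) (M ⊗ I) (I ⊗ F)` of `N` coupled agents. -/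
def systemMatrix {N : ℕ} {ν μ : Type*} [Fintype ν] [DecidableEq ν] [Fintype μ] [DecidableEq μ]
    (A : Matrix ν ν ℝ) (B : Matrix ν μ ℝ) (F : Matrix μ ν ℝ) (M : Matrix (Fin N) (Fin N) ℝ) :
    Matrix (Fin N × ν) (Fin N × ν) ℝ :=
  ((1 : Matrix (Fin N) (Fin N) ℝ) ⊗ₖ A) -
    ((1 : Matrix (Fin N) (Fin N) ℝ) ⊗ₖ B) * (M ⊗ₖ (1 : Matrix μ μ ℝ)) *
      ((1 : Matrix (Fin N) (Fin N) ℝ) ⊗ₖ F)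

end MAS

/-! A change of basis on the agent index that diagonalizes `𝓜` splits the network into `N`
independent agents `A - p i • (B * F)`, where the `p i` are the eigenvalues of `𝓜`
(`eigenvalues_systemMatrix`). It remains to locate the `p i` and to understand one agent as `p → ∞`.

Separation makes the Gershgorin intervals about the `d i` positive and disjoint. The characteristic
polynomial of `𝓜` changes sign across each, so each contains a real root `p i`
(`exists_isRoot_charpoly_couplingM`). Hence `𝓜` is diagonalizable, and `p i - d i` is bounded as
long as the weights are.

For one agent, suitable state coordinates turn `B * F` into `diag(0, Σ)` and the leading block of
`A` into `A₁₁ - A₁₂ * K`. Rescaling the characteristic polynomial, with continuity of roots, then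
yields `k` eigenvalues tending to the `s j`, while Gershgorin keeps the others within `O(1)` of `-p
σ j`. Replacing `p i` by `d i` costs only another `O(1)`. -/

namespace MAS

/-! ### Continuity of roots and labelling of multisets -/

/-- Continuity of the roots of a monic polynomial of fixed degree: if the values converge at all but
finitely many points, the roots can be relabelled so as to converge. -/
theorem exists_perm_tendsto_of_tendsto_prod_fin {ι : Type*} {l : Filter ι} {n : ℕ}
    (r : ι → Fin n → ℂ) (s : Fin n → ℂ)
    (h : ∀ᶠ x in cofinite, Tendsto (fun t => ∏ j, (x - r t j)) l (𝓝 (∏ j, (x - s j)))) :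
    ∃ π : ι → Equiv.Perm (Fin n), ∀ j, Tendsto (fun t => r t (π t j)) l (𝓝 (s j)) := by
  induction n with
  | zero => exact ⟨fun _ => 1, fun j => j.elim0⟩
  | succ n ih =>
    have hmin : ∀ t, ∃ i, ∀ j, ‖s 0 - r t i‖ ≤ ‖s 0 - r t j‖ := fun t =>
      Finite.exists_min fun j => ‖s 0 - r t j‖
    -- The root nearest to `s 0` is matched with `s 0`; the others are handled by induction.
    choose i hi using hmin
    have h0 : Tendsto (fun t => r t (i t)) l (𝓝 (s 0)) := by
      rw [Metric.tendsto_nhds]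
      intro ε hε
      -- At a test point `x` close to `s 0` the limit product is below `(ε / 2) ^ (n + 1)`, so
      -- eventually some factor `x - r t j` is smaller than `ε / 2`.
      have hcont : Tendsto (fun x => ‖∏ j, (x - s j)‖) (𝓝[≠] s 0) (𝓝 0) := by
        have : Continuous fun x => ‖∏ j, (x - s j)‖ := by fun_prop
        have h1 := this.tendsto (s 0)
        rw [Fin.prod_univ_succ, sub_self, zero_mul, norm_zero] at h1
        exact h1.mono_left nhdsWithin_le_nhds
      have hsmall := hcont.eventually_lt_const (show (0 : ℝ) < (ε / 2) ^ (n + 1) by positivity)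
      have hball : ∀ᶠ x in 𝓝[≠] s 0, dist x (s 0) < ε / 2 :=
        nhdsWithin_le_nhds (Metric.ball_mem_nhds _ (half_pos hε))
      have hne : ∀ᶠ x in 𝓝[≠] s 0,
          Tendsto (fun t => ∏ j, (x - r t j)) l (𝓝 (∏ j, (x - s j))) := by
        have hfin : {x | ¬ Tendsto (fun t => ∏ j, (x - r t j)) l (𝓝 (∏ j, (x - s j)))}.Finite := h
        have := (hfin.sdiff (t := {s 0})).isClosed.isOpen_compl.mem_nhds (x := s 0) (by simp)
        filter_upwards [nhdsWithin_le_nhds this, self_mem_nhdsWithin] with x hx hx'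
        by_contra hcon
        exact hx ⟨hcon, hx'⟩
      obtain ⟨x, hx1, hx2, hx3⟩ := (hsmall.and (hball.and hne)).exists
      filter_upwards [hx3.norm.eventually_lt_const hx1] with t ht
      obtain ⟨j, hj⟩ : ∃ j, ‖x - r t j‖ < ε / 2 := by
        by_contra! hcon
        have := Finset.prod_le_prod (s := Finset.univ) (f := fun _ : Fin (n + 1) => ε / 2)
          (fun _ _ => by positivity) fun j _ => hcon j
        rw [Finset.prod_const, Finset.card_univ, Fintype.card_fin, ← norm_prod] at this
        exact absurd ht this.not_gt
      calc dist (r t (i t)) (s 0) = ‖s 0 - r t (i t)‖ := by rw [dist_comm, dist_eq_norm]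
        _ ≤ ‖s 0 - r t j‖ := hi t j
        _ ≤ ‖s 0 - x‖ + ‖x - r t j‖ := norm_sub_le_norm_sub_add_norm_sub _ _ _
        _ < ε / 2 + ε / 2 := add_lt_add (by rwa [← dist_eq_norm, dist_comm]) hj
        _ = ε := add_halves ε
    have hsplit : ∀ t x, ∏ j, (x - r t j) =
        (x - r t (i t)) * ∏ j : Fin n, (x - r t (Equiv.swap 0 (i t) j.succ)) := by
      intro t x
      rw [← Equiv.prod_comp (Equiv.swap 0 (i t)), Fin.prod_univ_succ, Equiv.swap_apply_left]
    -- Dividing out the matched factor loses the point `x = s 0`; this is why convergence is assumed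
    -- only off a finite set.
    obtain ⟨π, hπ⟩ := ih (fun t j => r t (Equiv.swap 0 (i t) j.succ)) (fun j => s j.succ) (by
      filter_upwards [h, (Set.finite_singleton (s 0)).eventually_cofinite_notMem] with x hx hx0
      have hx0' : x - s 0 ≠ 0 := sub_ne_zero.2 hx0
      have hsub : Tendsto (fun t => x - r t (i t)) l (𝓝 (x - s 0)) := h0.const_sub x
      have hdiv := hx.div hsub hx0'
      rw [Fin.prod_univ_succ, mul_div_cancel_left₀ _ hx0'] at hdiv
      refine hdiv.congr' ?_
      filter_upwards [hsub.eventually_ne hx0'] with t ht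
      rw [Pi.div_apply, hsplit, mul_div_cancel_left₀ _ ht])
    refine ⟨fun t => Equiv.Perm.decomposeFin.symm (i t, π t), fun j => ?_⟩
    refine Fin.cases ?_ (fun j => ?_) j
    · simpa using h0
    · simpa using hπ j

theorem exists_perm_tendsto_of_tendsto_prod {ι α : Type*} [Fintype α] {l : Filter ι}
    (r : ι → α → ℂ) (s : α → ℂ)
    (h : ∀ x, Tendsto (fun t => ∏ j, (x - r t j)) l (𝓝 (∏ j, (x - s j)))) :
    ∃ π : ι → Equiv.Perm α, ∀ j, Tendsto (fun t => r t (π t j)) l (𝓝 (s j)) := by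
  let e := (Fintype.equivFin α).symm
  obtain ⟨π, hπ⟩ := exists_perm_tendsto_of_tendsto_prod_fin (fun t j => r t (e j))
    (fun j => s (e j)) (Eventually.of_forall fun x => by
      have h1 := fun t => e.prod_comp fun j => x - r t j
      simp only [h1, e.prod_comp fun j => x - s j]
      exact h x)
  exact ⟨fun t => (e.symm.trans (π t)).trans e, fun j => by simpa using hπ (e.symm j)⟩

theorem map_univ_val_comp_equiv {α β γ : Type*} [Fintype α] [Fintype β] (e : α ≃ β) (f : β → γ) :
    (Finset.univ : Finset α).val.map (fun a => f (e a)) = (Finset.univ : Finset β).val.map f := by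
  rw [← Multiset.map_univ_val_equiv e, Multiset.map_map]
  rfl

theorem exists_map_univ_eq {α β : Type*} [Fintype α] (S : Multiset β)
    (h : S.card = Fintype.card α) : ∃ f : α → β, S = (Finset.univ : Finset α).val.map f := by
  induction S using Quotient.inductionOn with | _ L => ?_
  let e : α ≃ Fin L.length := (Fintype.equivFin α).trans (finCongr (by simpa using h.symm))
  exact ⟨fun a => L.get (e a), by rw [map_univ_val_comp_equiv e fun a => L.get a]; simp⟩

/-! ### Eigenvalues under a large diagonal perturbation -/

section Charpoly

variable {α : Type*} [Fintype α] [DecidableEq α]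

theorem card_roots_charpoly (X : Matrix α α ℂ) :
    X.charpoly.roots.card = Fintype.card α := by
  rw [IsAlgClosed.card_roots_eq_natDegree, X.charpoly_natDegree_eq_dim]

theorem eval_charpoly_eq_prod {X : Matrix α α ℂ} {r : α → ℂ}
    (h : X.charpoly.roots = (Finset.univ : Finset α).val.map r) (x : ℂ) :
    X.charpoly.eval x = ∏ j, (x - r j) := by
  rw [(IsAlgClosed.splits X.charpoly).eval_eq_prod_roots_of_monic X.charpoly_monic, h,
    Multiset.map_map]
  rfl

/-- Gershgorin's theorem. It sharpens to `O(1)` the `o(p)` error that continuity of the rescaled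
roots gives. -/
theorem exists_norm_sub_diag_le_of_mem_roots {X : Matrix α α ℂ} {z : ℂ}
    (h : z ∈ X.charpoly.roots) :
    ∃ i, ‖z - X i i‖ ≤ ∑ j ∈ Finset.univ.erase i, ‖X i j‖ := by
  have h1 : z ∈ spectrum ℂ X :=
    Matrix.mem_spectrum_of_isRoot_charpoly (Polynomial.isRoot_of_mem_roots h)
  rw [← Matrix.spectrum_toLin', ← Module.End.hasEigenvalue_iff_mem_spectrum] at h1
  obtain ⟨i, hi⟩ := eigenvalue_mem_ball h1
  exact ⟨i, by rwa [mem_closedBall_iff_norm] at hi⟩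

/-- The eigenvalues of `X - p diag(δ)` are `-p δ j + O(1)` as `p → ∞`. -/
theorem exists_eigenvalues_sub_smul_diagonal (X : Matrix α α ℂ) (δ : α → ℝ) :
    ∃ μ : ℝ → α → ℂ,
      (∀ p : ℝ, (X - Matrix.diagonal fun j => ((p * δ j : ℝ) : ℂ)).charpoly.roots =
        (Finset.univ : Finset α).val.map (μ p)) ∧
      ∀ j, (fun p : ℝ => μ p j + ((p * δ j : ℝ) : ℂ)) =O[atTop] fun _ => (1 : ℝ) := by
  choose r hr using fun p : ℝ => exists_map_univ_eq (α := α) _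
    (card_roots_charpoly (X - Matrix.diagonal fun j => ((p * δ j : ℝ) : ℂ)))
  -- After division by `p` the matrix is `p⁻¹ X - diag(δ)`, whose eigenvalues tend to those of
  -- `-diag(δ)`.
  obtain ⟨π, hπ⟩ := exists_perm_tendsto_of_tendsto_prod (l := atTop)
    (fun (p : ℝ) j => r p j / p) (fun j => (-δ j : ℂ)) (fun x => by
      have hinv : Tendsto (fun p : ℝ => ((p⁻¹ : ℝ) : ℂ)) atTop (𝓝 0) := by
        simpa only [Complex.ofReal_zero, Function.comp_def] using
          (Complex.continuous_ofReal.tendsto 0).comp tendsto_inv_atTop_zero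
      have hdet : Continuous fun q : ℂ =>
          ((Matrix.diagonal fun j => x + (δ j : ℂ)) - q • X).det := by fun_prop
      have h1 := (hdet.tendsto 0).comp hinv
      rw [zero_smul, sub_zero, Matrix.det_diagonal] at h1
      simp only [sub_neg_eq_add]
      refine h1.congr' ?_
      filter_upwards [eventually_ne_atTop 0] with p hp
      have hp' : (p : ℂ) ≠ 0 := Complex.ofReal_ne_zero.2 hp
      have h2 := eval_charpoly_eq_prod (hr p) (p * x)
      rw [Matrix.eval_charpoly] at h2
      have h3 : Matrix.scalar α (p * x) - (X - Matrix.diagonal fun j => ((p * δ j : ℝ) : ℂ)) =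
          (p : ℂ) • ((Matrix.diagonal fun j => x + (δ j : ℂ)) - ((p⁻¹ : ℝ) : ℂ) • X) := by
        ext a b
        by_cases hab : a = b
        · subst hab
          simp
          field_simp
          ring
        · simp [hab, hp']
      rw [h3, Matrix.det_smul] at h2
      have h4 : ∏ j, (x - r p j / p) = (∏ j, (p * x - r p j)) / (p : ℂ) ^ Fintype.card α := by
        rw [← Finset.card_univ, ← Finset.prod_const, ← Finset.prod_div_distrib]
        refine Finset.prod_congr rfl fun j _ => ?_
        field_simp
      rw [h4, ← h2, mul_div_cancel_left₀ _ (pow_ne_zero _ hp')]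
      rfl)
  refine ⟨fun p j => r p (π p j), fun p => ?_, fun j => ?_⟩
  · rw [hr p, map_univ_val_comp_equiv (π p) (r p)]
  set C : ℝ := ∑ i, ∑ b, ‖X i b‖ with hC
  have hger : ∀ p, ∃ i, ‖r p (π p j) + ((p * δ i : ℝ) : ℂ)‖ ≤ C := by
    intro p
    obtain ⟨i, hi⟩ := exists_norm_sub_diag_le_of_mem_roots (z := r p (π p j)) (by
      rw [hr p]; exact Multiset.mem_map_of_mem _ (Finset.mem_univ _))
    refine ⟨i, ?_⟩
    have h1 : ∑ b ∈ Finset.univ.erase i,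
        ‖(X - Matrix.diagonal fun j => ((p * δ j : ℝ) : ℂ)) i b‖ =
        ∑ b ∈ Finset.univ.erase i, ‖X i b‖ := Finset.sum_congr rfl fun b hb => by
      simp [Matrix.diagonal_apply_ne' _ (Finset.ne_of_mem_erase hb)]
    rw [h1] at hi
    calc ‖r p (π p j) + ((p * δ i : ℝ) : ℂ)‖
        = ‖(r p (π p j) - (X - Matrix.diagonal fun j => ((p * δ j : ℝ) : ℂ)) i i) + X i i‖ := by
          congr 1; simp; ring
      _ ≤ ∑ b ∈ Finset.univ.erase i, ‖X i b‖ + ‖X i i‖ := (norm_add_le _ _).trans (by gcongr)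
      _ = ∑ b, ‖X i b‖ := Finset.sum_erase_add _ _ (Finset.mem_univ i)
      _ ≤ C := Finset.single_le_sum (f := fun i => ∑ b, ‖X i b‖)
          (fun _ _ => Finset.sum_nonneg fun _ _ => norm_nonneg _) (Finset.mem_univ i)
  -- The disc containing the `j`-th root must have centre parameter `δ j`: its distance to `-p δ i`
  -- grows linearly when `δ i ≠ δ j`. Repeated values of `δ` do no harm.
  have hfar : ∀ᶠ p : ℝ in atTop, ∀ i, δ i ≠ δ j →
      C < ‖r p (π p j) + ((p * δ i : ℝ) : ℂ)‖ := by
    rw [eventually_all]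
    intro i
    by_cases hij : δ i = δ j
    · simp [hij]
    have h1 : Tendsto (fun p : ℝ => ‖r p (π p j) / p + (δ i : ℂ)‖) atTop
        (𝓝 ‖-(δ j : ℂ) + δ i‖) := ((hπ j).add_const _).norm
    have hpos : 0 < ‖-(δ j : ℂ) + δ i‖ := by
      rw [norm_pos_iff, neg_add_eq_sub, sub_ne_zero]
      exact_mod_cast hij
    filter_upwards [(tendsto_id.atTop_mul_pos hpos h1).eventually_gt_atTop C,
      eventually_gt_atTop 0] with p hp hp0 _
    have hp' : (p : ℂ) ≠ 0 := Complex.ofReal_ne_zero.2 hp0.ne'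
    have : r p (π p j) + ((p * δ i : ℝ) : ℂ) = (p : ℂ) * (r p (π p j) / p + (δ i : ℂ)) := by
      push_cast; field_simp
    rw [this, norm_mul, Complex.norm_of_nonneg hp0.le]
    exact hp
  refine IsBigO.of_bound C ?_
  filter_upwards [hfar] with p hp
  obtain ⟨i, hi⟩ := hger p
  by_cases hij : δ i = δ j
  · simpa [hij] using hi
  · exact absurd hi (hp i hij).not_ge

end Charpoly

end MAS

/-! ### Large perturbation of one diagonal block -/

namespace MAS

/-- The eigenvalues of `X - p diag(0, σ)` as `p → ∞`: those belonging to the first block converge to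
the eigenvalues of `X₁₁`, the others are `-p σ j + O(1)`. -/
theorem exists_eigenvalues_sub_smul_fromBlocks {κ μ : Type*} [Fintype κ] [DecidableEq κ]
    [Fintype μ] [DecidableEq μ] (X : Matrix (κ ⊕ μ) (κ ⊕ μ) ℂ) (σ : μ → ℝ) (hσ : ∀ j, 0 < σ j)
    (s : κ → ℂ) (hs : X.toBlocks₁₁.charpoly.roots = (Finset.univ : Finset κ).val.map s) :
    ∃ lam : ℝ → κ ⊕ μ → ℂ,
      (∀ p : ℝ, (X - Matrix.diagonal fun j => ((p * Sum.elim (0 : κ → ℝ) σ j : ℝ) : ℂ)).charpoly.roots =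
        (Finset.univ : Finset (κ ⊕ μ)).val.map (lam p)) ∧
      (∀ j, Tendsto (fun p => lam p (Sum.inl j)) atTop (𝓝 (s j))) ∧
      ∀ j, (fun p : ℝ => lam p (Sum.inr j) + ((p * σ j : ℝ) : ℂ)) =O[atTop] fun _ => (1 : ℝ) := by
  obtain ⟨r, hr, hrO⟩ := exists_eigenvalues_sub_smul_diagonal X (Sum.elim (0 : κ → ℝ) σ)
  have hinv : ∀ j, Tendsto (fun p : ℝ => ((p * σ j : ℝ) : ℂ)⁻¹) atTop (𝓝 0) := fun j =>
    tendsto_inv₀_cobounded.comp <| tendsto_norm_atTop_iff_cobounded.1 <| by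
      simpa only [Complex.norm_real, Function.comp_def, id] using
        tendsto_norm_atTop_atTop.comp (tendsto_id.atTop_mul_const (hσ j))
  have hne : ∀ᶠ p : ℝ in atTop, ∀ j, ((p * σ j : ℝ) : ℂ) ≠ 0 := by
    filter_upwards [eventually_gt_atTop 0] with p hp j
    exact Complex.ofReal_ne_zero.2 (mul_pos hp (hσ j)).ne'
  have hlarge : ∀ (x : ℂ) j,
      Tendsto (fun p : ℝ => ((p * σ j : ℝ) : ℂ)⁻¹ * (x - r p (Sum.inr j))) atTop (𝓝 1) := by
    intro x j
    have h1 : (fun p : ℝ => x - (r p (Sum.inr j) + ((p * σ j : ℝ) : ℂ))) =O[atTop]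
        fun _ => (1 : ℝ) := (isBigO_const_const x one_ne_zero _).sub (hrO (Sum.inr j))
    have h2 : Tendsto (fun p : ℝ =>
        ((p * σ j : ℝ) : ℂ)⁻¹ * (x - (r p (Sum.inr j) + ((p * σ j : ℝ) : ℂ)))) atTop (𝓝 0) := by
      rw [← isLittleO_one_iff ℝ]
      simpa using ((isLittleO_one_iff ℝ).2 (hinv j)).mul_isBigO h1
    have h3 := h2.add_const 1
    rw [zero_add] at h3
    refine h3.congr' ?_
    filter_upwards [hne] with p hp
    have := hp j
    field_simp
    ring
  -- Dividing row `j` of the second block by `p σ j` sends that block row to `[0 I]`, leaving a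
  -- block triangular determinant in the limit.
  have hdet : ∀ x : ℂ, Tendsto (fun p : ℝ => (∏ j, ((p * σ j : ℝ) : ℂ)⁻¹) *
      (X - Matrix.diagonal fun j => ((p * Sum.elim (0 : κ → ℝ) σ j : ℝ) : ℂ)).charpoly.eval x) atTop
      (𝓝 (X.toBlocks₁₁.charpoly.eval x)) := by
    intro x
    have hlim : (Matrix.fromBlocks (Matrix.scalar κ x - X.toBlocks₁₁) (-X.toBlocks₁₂) 0 1).det =
        X.toBlocks₁₁.charpoly.eval x := by
      rw [Matrix.det_fromBlocks_zero₂₁, Matrix.det_one, mul_one, Matrix.eval_charpoly]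
    rw [← hlim]
    let v : ℝ → κ ⊕ μ → ℂ := fun p => Sum.elim 1 fun j => ((p * σ j : ℝ) : ℂ)⁻¹
    have hv : ∀ p, ∏ j, v p j = ∏ j, ((p * σ j : ℝ) : ℂ)⁻¹ := fun p => by simp [v]
    simp_rw [← hv, Matrix.eval_charpoly, ← Matrix.det_mul_column]
    refine (Continuous.tendsto (by fun_prop : Continuous fun Y : Matrix (κ ⊕ μ) (κ ⊕ μ) ℂ => Y.det)
      _).comp ?_
    refine tendsto_pi_nhds.2 fun a => tendsto_pi_nhds.2 fun b => ?_
    rcases a with a | a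
    · rcases b with b | b
      · by_cases hab : a = b
        · subst hab
          simp [v, Matrix.toBlocks₁₁]
        · simp [v, hab, Matrix.toBlocks₁₁]
      · simp [v, Matrix.toBlocks₁₂]
    · rcases b with b | b
      · simpa [v] using (hinv a).mul_const (-X (Sum.inr a) (Sum.inl b))
      · by_cases hab : a = b
        · subst hab
          have h3 := ((hinv a).mul_const (x - X (Sum.inr a) (Sum.inr a))).add_const 1
          rw [zero_mul, zero_add] at h3
          simp only [Matrix.fromBlocks_apply₂₂, Matrix.one_apply_eq]
          refine h3.congr' ?_
          filter_upwards [hne] with p hp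
          have := hp a
          simp only [v, Matrix.of_apply, Sum.elim_inr, Matrix.sub_apply, Matrix.scalar_apply,
            Matrix.diagonal_apply_eq]
          field_simp
          ring
        · simpa [v, hab] using (hinv a).mul_const (-X (Sum.inr a) (Sum.inr b))
  -- The large roots account for the normalizing factor, by `hlarge`; the product over the remaining
  -- roots converges to the characteristic polynomial of `X₁₁`.
  obtain ⟨π, hπ⟩ := exists_perm_tendsto_of_tendsto_prod (l := atTop)
    (fun p j => r p (Sum.inl j)) s (fun x => by
      have hprod := tendsto_finsetProd (Finset.univ : Finset μ) fun j _ => hlarge x j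
      rw [Finset.prod_const_one] at hprod
      have h1 := (hdet x).div hprod one_ne_zero
      rw [div_one, eval_charpoly_eq_prod hs] at h1
      refine h1.congr' ?_
      filter_upwards [hprod.eventually_ne one_ne_zero] with p hp
      rw [Pi.div_apply, div_eq_iff hp, eval_charpoly_eq_prod (hr p), Fintype.prod_sum_type,
        Finset.prod_mul_distrib]
      ring)
  refine ⟨fun p j => r p (Equiv.sumCongr (π p) (Equiv.refl μ) j), fun p => ?_, fun j => ?_,
    fun j => ?_⟩
  · rw [hr p, map_univ_val_comp_equiv _ (r p)]
  · simpa using hπ j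
  · simpa using hrO (Sum.inr j)

end MAS

/-! ### Separated coupling matrices: real, distinct, positive eigenvalues -/

namespace MAS

section Separated

variable {N : ℕ} {d : Fin N → ℝ} {a : Matrix (Fin N) (Fin N) ℝ}

theorem IsCoupling.rowSum_nonneg (ha : IsCoupling a) (i : Fin N) : 0 ≤ rowSum a i :=
  Finset.sum_nonneg fun j _ => ha.1 i j

/-- All the Gershgorin intervals of a separated pair are positive and pairwise disjoint. -/
theorem GershgorinSeparated.pos_and_disjoint (ha : IsCoupling a) (h : GershgorinSeparated d a) :
    (∀ i, rowSum a i < d i) ∧ ∀ i j, i ≠ j → rowSum a i + rowSum a j < |d i - d j| := by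
  obtain ⟨κ, h0, hsucc⟩ := h
  have hlt : ∀ (e : ℕ) (i j : Fin N), (j : ℕ) = i + e + 1 →
      rowSum a (κ j) + rowSum a (κ i) < d (κ j) - d (κ i) := by
    intro e
    induction e with
    | zero => intro i j hij; exact hsucc i j (by simpa using hij)
    | succ e ih =>
      intro i j hij
      have h1 := ih i ⟨i + e + 1, by omega⟩ rfl
      have h2 := hsucc ⟨i + e + 1, by omega⟩ j (by simp only; omega)
      linarith [ha.rowSum_nonneg (κ ⟨i + e + 1, by omega⟩)]
  have hlt' : ∀ i j : Fin N, i < j → rowSum a (κ j) + rowSum a (κ i) < d (κ j) - d (κ i) :=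
    fun i j hij => hlt (j - i - 1) i j (by have : (i : ℕ) < j := hij; omega)
  constructor
  · intro i
    obtain ⟨i, rfl⟩ := κ.surjective i
    rcases Nat.eq_zero_or_pos (i : ℕ) with hi | hi
    · exact h0 i hi
    · have h1 := h0 ⟨0, by omega⟩ rfl
      have h2 := hlt' ⟨0, by omega⟩ i hi
      linarith [ha.rowSum_nonneg (κ ⟨0, by omega⟩)]
  · intro i j hij
    obtain ⟨i, rfl⟩ := κ.surjective i
    obtain ⟨j, rfl⟩ := κ.surjective j
    rcases lt_trichotomy i j with h | rfl | h
    · rw [abs_sub_comm]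
      linarith [hlt' i j h, le_abs_self (d (κ j) - d (κ i))]
    · exact absurd rfl hij
    · linarith [hlt' j i h, le_abs_self (d (κ i) - d (κ j))]

/-- Outside the Gershgorin discs, the characteristic polynomial of `𝓜` has the sign of
`∏ i, (x - d i)`. -/
theorem eval_charpoly_couplingM_mul_prod_pos (ha : IsCoupling a) {x : ℝ}
    (hx : ∀ i, rowSum a i < |x - d i|) :
    0 < (couplingM d a).charpoly.eval x * ∏ i, (x - d i) := by
  -- Homotopy from `diag(d)` to `𝓜`: strict diagonal dominance keeps the determinant nonzero, so its
  -- sign is constant.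
  let f : ℝ → ℝ := fun c => (Matrix.diagonal (fun i => x - d i) + c • a).det
  have hf : Continuous f := by fun_prop
  have hne : ∀ c ∈ Set.Icc (0 : ℝ) 1, f c ≠ 0 := by
    intro c hc
    refine det_ne_zero_of_sum_row_lt_diag fun i => ?_
    have h1 : ∑ j ∈ Finset.univ.erase i, ‖(Matrix.diagonal (fun i => x - d i) + c • a) i j‖ ≤
        ∑ j ∈ Finset.univ.erase i, a i j := Finset.sum_le_sum fun j hj => by
      rw [Matrix.add_apply, Matrix.diagonal_apply_ne' _ (Finset.ne_of_mem_erase hj), zero_add,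
        Matrix.smul_apply, smul_eq_mul, Real.norm_of_nonneg (mul_nonneg hc.1 (ha.1 i j))]
      exact mul_le_of_le_one_left (ha.1 i j) hc.2
    have h2 : ∑ j ∈ Finset.univ.erase i, a i j = rowSum a i :=
      Finset.sum_erase _ (ha.2 i)
    refine (h1.trans_eq h2).trans_lt ?_
    simpa [ha.2 i] using hx i
  have h0 : f 0 = ∏ i, (x - d i) := by simp [f]
  have h1 : f 1 = (couplingM d a).charpoly.eval x := by
    rw [Matrix.eval_charpoly]
    refine congrArg Matrix.det ?_
    ext i j
    by_cases hij : i = j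
    · simp [couplingM, hij]
      ring
    · simp [couplingM, hij]
  rw [← h0, ← h1]
  by_contra! hcon
  have hmem : (0 : ℝ) ∈ f '' Set.Icc 0 1 := by
    rcases mul_nonpos_iff.1 hcon with ⟨h, h'⟩ | ⟨h, h'⟩
    · exact intermediate_value_Icc zero_le_one hf.continuousOn ⟨h', h⟩
    · exact intermediate_value_Icc' zero_le_one hf.continuousOn ⟨h, h'⟩
  obtain ⟨c, hc, hc0⟩ := hmem
  exact hne c hc hc0

/-- A separated `𝓜` has distinct positive eigenvalues, one near each diagonal entry. -/
theorem exists_isRoot_charpoly_couplingM (ha : IsCoupling a) (h : GershgorinSeparated d a) :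
    ∃ p : Fin N → ℝ, Function.Injective p ∧ (∀ i, 0 < p i) ∧
      (∀ i, (couplingM d a).charpoly.IsRoot (p i)) ∧ ∀ i, |p i - d i| ≤ rowSum a i + 1 := by
  obtain ⟨hpos, hdisj⟩ := h.pos_and_disjoint ha
  have hr := ha.rowSum_nonneg
  -- The intervals are enlarged by `ε` so that their endpoints lie strictly outside all discs, even
  -- when a row sum vanishes. Strictness of the separation leaves room for this.
  obtain ⟨ε, hε1, hε2, hε0, hεle⟩ : ∃ ε : ℝ, (∀ i, rowSum a i + ε < d i) ∧
      (∀ i j, i ≠ j → rowSum a i + rowSum a j + 2 * ε < |d i - d j|) ∧ 0 < ε ∧ ε < 1 := by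
    have e1 : ∀ᶠ ε : ℝ in 𝓝[>] 0, ∀ i, rowSum a i + ε < d i := eventually_all.2 fun i =>
      nhdsWithin_le_nhds <| Tendsto.eventually_lt_const (hpos i) <|
        Continuous.tendsto' (by fun_prop) _ _ (by simp)
    have e2 : ∀ᶠ ε : ℝ in 𝓝[>] 0, ∀ i j, i ≠ j →
        rowSum a i + rowSum a j + 2 * ε < |d i - d j| := by
      simp only [eventually_all]
      exact fun i j hij => nhdsWithin_le_nhds <| Tendsto.eventually_lt_const (hdisj i j hij) <|
        Continuous.tendsto' (by fun_prop) _ _ (by simp)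
    have e3 : ∀ᶠ ε : ℝ in 𝓝[>] 0, 0 < ε := self_mem_nhdsWithin
    have e4 : ∀ᶠ ε : ℝ in 𝓝[>] 0, ε < 1 := nhdsWithin_le_nhds (eventually_lt_nhds zero_lt_one)
    exact (e1.and (e2.and (e3.and e4))).exists
  let χ : ℝ → ℝ := fun x => (couplingM d a).charpoly.eval x
  have hχ : Continuous χ := (couplingM d a).charpoly.continuous
  have hroot : ∀ i, ∃ x ∈ Set.Icc (d i - (rowSum a i + ε)) (d i + (rowSum a i + ε)), χ x = 0 := by
    intro i
    have hout : ∀ x, |x - d i| = rowSum a i + ε → ∀ j, rowSum a j < |x - d j| := by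
      intro x hx j
      rcases eq_or_ne i j with rfl | hij
      · linarith
      · have h1 := hε2 i j hij
        have h2 := abs_sub_le (d i) x (d j)
        rw [abs_sub_comm (d i) x] at h2
        linarith
    have hnn : 0 ≤ rowSum a i + ε := by linarith [hr i]
    have hl := eval_charpoly_couplingM_mul_prod_pos ha
      (hout (d i - (rowSum a i + ε)) (by rw [sub_sub_cancel_left, abs_neg, abs_of_nonneg hnn]))
    have hu := eval_charpoly_couplingM_mul_prod_pos ha
      (hout (d i + (rowSum a i + ε)) (by rw [add_sub_cancel_left, abs_of_nonneg hnn]))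
    -- The `j`-th factor is `(d i - d j)² - (rowSum a i + ε)²`, negative only for `j = i`.
    have hsign : (∏ j, (d i - (rowSum a i + ε) - d j)) * ∏ j, (d i + (rowSum a i + ε) - d j) < 0 := by
      rw [← Finset.prod_mul_distrib, ← Finset.mul_prod_erase _ _ (Finset.mem_univ i)]
      refine mul_neg_of_neg_of_pos ?_ (Finset.prod_pos fun j hj => ?_)
      · nlinarith [hr i]
      · have h1 := hε2 i j (Finset.ne_of_mem_erase hj).symm
        have h2 : (rowSum a i + ε) ^ 2 < (d i - d j) ^ 2 := by
          rw [← sq_abs (d i - d j)]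
          exact pow_lt_pow_left₀ (by linarith [hr j]) hnn two_ne_zero
        nlinarith
    have hneg : χ (d i - (rowSum a i + ε)) * χ (d i + (rowSum a i + ε)) < 0 := by
      by_contra! hcon
      nlinarith [mul_pos hl hu, mul_nonneg hcon (neg_nonneg.2 hsign.le)]
    have hle : d i - (rowSum a i + ε) ≤ d i + (rowSum a i + ε) := by linarith
    rcases mul_nonpos_iff.1 hneg.le with ⟨h, h'⟩ | ⟨h, h'⟩
    · exact intermediate_value_Icc' hle hχ.continuousOn ⟨h', h⟩
    · exact intermediate_value_Icc hle hχ.continuousOn ⟨h, h'⟩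
  choose p hp hp0 using hroot
  have hpd : ∀ i, |p i - d i| ≤ rowSum a i + ε := fun i =>
    abs_le.2 ⟨by linarith [(hp i).1], by linarith [(hp i).2]⟩
  refine ⟨p, fun i j hij => ?_, fun i => ?_, hp0, fun i => (hpd i).trans (by linarith)⟩
  · by_contra hne
    have h1 := hε2 i j hne
    have h2 := abs_sub_le (d i) (p i) (d j)
    rw [abs_sub_comm (d i) (p i)] at h2
    have h3 := hpd j
    rw [← hij] at h3
    linarith [hpd i]
  · linarith [(hp i).1, hε1 i]

end Separated

/-- A matrix with as many distinct eigenvalues as its size is diagonalizable. -/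
theorem exists_conj_eq_diagonal_of_injective {α 𝕜 : Type*} [Fintype α] [DecidableEq α] [Field 𝕜]
    (M : Matrix α α 𝕜) (p : α → 𝕜) (hp : Function.Injective p)
    (hroot : ∀ i, M.charpoly.IsRoot (p i)) :
    ∃ T : Matrix α α 𝕜, T.det ≠ 0 ∧ T * M * T⁻¹ = Matrix.diagonal p := by
  have hev : ∀ i, ∃ v, Module.End.HasEigenvector (Matrix.toLin' M) (p i) v := fun i => by
    refine Module.End.HasEigenvalue.exists_hasEigenvector ?_
    rw [Module.End.hasEigenvalue_iff_mem_spectrum, Matrix.spectrum_toLin']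
    exact Matrix.mem_spectrum_iff_isRoot_charpoly.2 (hroot i)
  choose v hv using hev
  have hli : LinearIndependent 𝕜 v :=
    Module.End.eigenvectors_linearIndependent' (Matrix.toLin' M) p hp v hv
  let P : Matrix α α 𝕜 := (Matrix.of v)ᵀ
  have hP : IsUnit P := Matrix.linearIndependent_cols_iff_isUnit.1 hli
  have hPdet : IsUnit P.det := (Matrix.isUnit_iff_isUnit_det P).1 hP
  have hMP : M * P = P * Matrix.diagonal p := by
    ext i j
    have := congrFun (Module.End.mem_eigenspace_iff.1 (hv j).1) i
    rw [Matrix.toLin'_apply] at this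
    rw [Matrix.mul_diagonal]
    simpa [P, Matrix.mul_apply, Matrix.mulVec, dotProduct, mul_comm] using this
  refine ⟨P⁻¹, (Matrix.isUnit_nonsing_inv_det P hPdet).ne_zero, ?_⟩
  rw [Matrix.nonsing_inv_nonsing_inv P hPdet, Matrix.mul_assoc, hMP, ← Matrix.mul_assoc,
    Matrix.nonsing_inv_mul P hPdet, Matrix.one_mul]

end MAS

/-! ### Decoupling the network, and one agent under high gain -/

namespace MAS

theorem charpoly_blockDiagonal {o ν R : Type*} [Fintype o] [DecidableEq o] [Fintype ν]
    [DecidableEq ν] [CommRing R] (X : o → Matrix ν ν R) :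
    (Matrix.blockDiagonal X).charpoly = ∏ i, (X i).charpoly := by
  have h : (Matrix.blockDiagonal X).charmatrix =
      Matrix.blockDiagonal fun i => (X i).charmatrix := by
    ext1 ⟨a, i⟩ ⟨b, j⟩
    rw [Matrix.charmatrix_apply, Matrix.blockDiagonal_apply, Matrix.blockDiagonal_apply]
    by_cases hij : i = j
    · subst hij
      simp [Matrix.charmatrix_apply, Matrix.diagonal_apply]
    · simp [hij]
  rw [Matrix.charpoly, h, Matrix.det_blockDiagonal]
  rfl

theorem charpoly_conj {ν R : Type*} [Fintype ν] [DecidableEq ν] [CommRing R]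
    {P P' : Matrix ν ν R} (h : P' * P = 1) (X : Matrix ν ν R) :
    (P * X * P').charpoly = X.charpoly := by
  rw [Matrix.charpoly_mul_comm, ← Matrix.mul_assoc, h, Matrix.one_mul]

theorem eigenvalues_eq_roots_map_charpoly {ν : Type*} [Fintype ν] [DecidableEq ν]
    (X : Matrix ν ν ℝ) : eigenvalues X = (X.charpoly.map Complex.ofRealHom).roots := by
  rw [← Matrix.charpoly_map]
  rfl

theorem systemMatrix_eq {N : ℕ} {ν μ : Type*} [Fintype ν] [DecidableEq ν] [Fintype μ]
    [DecidableEq μ] (A : Matrix ν ν ℝ) (B : Matrix ν μ ℝ) (F : Matrix μ ν ℝ)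
    (M : Matrix (Fin N) (Fin N) ℝ) : systemMatrix A B F M = 1 ⊗ₖ A - M ⊗ₖ (B * F) := by
  rw [systemMatrix, ← Matrix.mul_kronecker_mul, ← Matrix.mul_kronecker_mul, Matrix.one_mul,
    Matrix.mul_one, Matrix.mul_one]

/-- Conjugation by `T ⊗ I` fixes `I ⊗ A` and turns `M ⊗ (B * F)` into `diag(p) ⊗ (B * F)`, which is
block diagonal after swapping the two indices. -/
theorem eigenvalues_systemMatrix {N : ℕ} {ν μ : Type*} [Fintype ν] [DecidableEq ν] [Fintype μ]
    [DecidableEq μ] (A : Matrix ν ν ℝ) (B : Matrix ν μ ℝ) (F : Matrix μ ν ℝ)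
    (M T : Matrix (Fin N) (Fin N) ℝ) (p : Fin N → ℝ) (hT : T.det ≠ 0)
    (h : T * M * T⁻¹ = Matrix.diagonal p) :
    eigenvalues (systemMatrix A B F M) = ∑ i, eigenvalues (A - p i • (B * F)) := by
  have hT' : IsUnit T.det := isUnit_iff_ne_zero.2 hT
  have hconj : (T ⊗ₖ (1 : Matrix ν ν ℝ)) * systemMatrix A B F M * (T⁻¹ ⊗ₖ (1 : Matrix ν ν ℝ)) =
      Matrix.reindex (Equiv.prodComm _ _) (Equiv.prodComm _ _)
        (Matrix.blockDiagonal fun i => A - p i • (B * F)) := by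
    rw [systemMatrix_eq, Matrix.mul_sub, Matrix.sub_mul]
    simp only [← Matrix.mul_kronecker_mul, Matrix.mul_one, Matrix.one_mul,
      Matrix.mul_nonsing_inv T hT', h]
    rw [Matrix.one_kronecker, Matrix.diagonal_kronecker]
    ext ⟨i, b⟩ ⟨j, c⟩
    by_cases hij : i = j <;> simp [Matrix.blockDiagonal_apply, hij]
  have hchar : (systemMatrix A B F M).charpoly = ∏ i, (A - p i • (B * F)).charpoly := by
    rw [← charpoly_blockDiagonal, ← Matrix.charpoly_reindex (Equiv.prodComm ν (Fin N)),
      ← hconj,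
      charpoly_conj]
    rw [← Matrix.mul_kronecker_mul, Matrix.nonsing_inv_mul T hT', Matrix.one_mul,
      Matrix.one_kronecker_one]
  simp only [eigenvalues_eq_roots_map_charpoly]
  rw [hchar, Polynomial.map_prod, Polynomial.roots_prod]
  · rfl
  · exact Finset.prod_ne_zero_iff.2 fun i _ => ((Matrix.charpoly_monic _).map _).ne_zero

/-- The eigenvalues of a single agent `A - p B F` under high gain `p → ∞`. -/
theorem exists_eigenvalues_highGain {k m : ℕ}
    (A₁₁ : Matrix (Fin k) (Fin k) ℝ) (A₁₂ : Matrix (Fin k) (Fin m) ℝ)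
    (A₂₁ : Matrix (Fin m) (Fin k) ℝ) (A₂₂ : Matrix (Fin m) (Fin m) ℝ)
    (B₂ : Matrix (Fin m) (Fin m) ℝ) (hB₂ : B₂.det ≠ 0)
    (V : Matrix (Fin m) (Fin m) ℝ) (hV : V.det ≠ 0)
    (σ : Fin m → ℝ) (hσ : ∀ j, 0 < σ j) (K : Matrix (Fin m) (Fin k) ℝ) (s : Fin k → ℂ)
    (hs : eigenvalues (A₁₁ - A₁₂ * K) = (Finset.univ : Finset (Fin k)).val.map s) :
    ∃ lam : ℝ → Fin k ⊕ Fin m → ℂ,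
      (∀ p : ℝ, eigenvalues (Matrix.fromBlocks A₁₁ A₁₂ A₂₁ A₂₂ - p • (Matrix.fromRows 0 B₂ *
          (B₂⁻¹ * V⁻¹ * Matrix.diagonal σ * V * Matrix.fromCols K 1))) =
        (Finset.univ : Finset (Fin k ⊕ Fin m)).val.map (lam p)) ∧
      (∀ j, Tendsto (fun p => lam p (Sum.inl j)) atTop (𝓝 (s j))) ∧
      ∀ j, (fun p : ℝ => lam p (Sum.inr j) + ((p * σ j : ℝ) : ℂ)) =O[atTop] fun _ => (1 : ℝ) := by
  have hB₂' : IsUnit B₂.det := isUnit_iff_ne_zero.2 hB₂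
  have hV' : IsUnit V.det := isUnit_iff_ne_zero.2 hV
  -- New coordinates `(z₁, V (K z₁ + z₂))`: the second component is, up to an invertible factor, the
  -- quantity fed back by `F`.
  let W : Matrix (Fin k ⊕ Fin m) (Fin k ⊕ Fin m) ℝ := Matrix.fromBlocks 1 0 (V * K) V
  let W' : Matrix (Fin k ⊕ Fin m) (Fin k ⊕ Fin m) ℝ := Matrix.fromBlocks 1 0 (-K) V⁻¹
  have hW : W' * W = 1 := by
    simp [W, W', Matrix.fromBlocks_multiply, Matrix.nonsing_inv_mul V hV',
      Matrix.nonsing_inv_mul_cancel_left _ _ hV']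
  let X := W * Matrix.fromBlocks A₁₁ A₁₂ A₂₁ A₂₂ * W'
  have hX : X.toBlocks₁₁ = A₁₁ - A₁₂ * K := by
    simp [X, W, W', Matrix.fromBlocks_multiply, sub_eq_add_neg]
  have hBF : W * (Matrix.fromRows 0 B₂ *
      (B₂⁻¹ * V⁻¹ * Matrix.diagonal σ * V * Matrix.fromCols K 1)) * W' =
      Matrix.diagonal (Sum.elim (0 : Fin k → ℝ) σ) := by
    have h1 : Matrix.fromRows (0 : Matrix (Fin k) (Fin m) ℝ) B₂ *
        (B₂⁻¹ * V⁻¹ * Matrix.diagonal σ * V *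
          Matrix.fromCols K (1 : Matrix (Fin m) (Fin m) ℝ)) =
        Matrix.fromRows 0 (V⁻¹ * Matrix.diagonal σ * V) *
          Matrix.fromCols K (1 : Matrix (Fin m) (Fin m) ℝ) := by
      simp only [← Matrix.mul_assoc, Matrix.fromRows_mul, Matrix.zero_mul,
        Matrix.mul_nonsing_inv B₂ hB₂', Matrix.one_mul]
    have h2 : W * Matrix.fromRows (0 : Matrix (Fin k) (Fin m) ℝ) (V⁻¹ * Matrix.diagonal σ * V) =
        Matrix.fromRows 0 (Matrix.diagonal σ * V) := by
      simp only [W, Matrix.fromBlocks_mul_fromRows, Matrix.mul_zero, Matrix.zero_mul, zero_add,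
        ← Matrix.mul_assoc, Matrix.mul_nonsing_inv V hV', Matrix.one_mul]
    have h3 : Matrix.fromCols K (1 : Matrix (Fin m) (Fin m) ℝ) * W' =
        Matrix.fromCols (0 : Matrix (Fin m) (Fin k) ℝ) V⁻¹ := by
      simp [W', Matrix.fromCols_mul_fromBlocks]
    rw [h1, ← Matrix.mul_assoc, h2, Matrix.mul_assoc, h3, Matrix.fromRows_mul_fromCols,
      Matrix.mul_nonsing_inv_cancel_right _ _ hV']
    ext (a | a) (b | b) <;> simp [Matrix.diagonal_apply]
  obtain ⟨lam, h1, h2⟩ := exists_eigenvalues_sub_smul_fromBlocks (X.map Complex.ofReal) σ hσ s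
    (by rw [← hs, ← hX]; rfl)
  refine ⟨lam, fun p => ?_, h2⟩
  rw [← h1 p, eigenvalues_eq_roots_map_charpoly, ← charpoly_conj hW, ← Matrix.charpoly_map,
    Matrix.mul_sub, Matrix.sub_mul, Matrix.mul_smul, Matrix.smul_mul, hBF]
  congr 2
  ext a b
  by_cases hab : a = b
  · subst hab
    simp [X]
  · simp [X, hab]

end MAS

/-! ### The main theorem -/

theorem theorem3 {k m N : ℕ}
    -- the agents: state dimension `n = k + m`, input dimension `m`, block structure of `A` and `B`
    (A₁₁ : Matrix (Fin k) (Fin k) ℝ) (A₁₂ : Matrix (Fin k) (Fin m) ℝ)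
    (A₂₁ : Matrix (Fin m) (Fin k) ℝ) (A₂₂ : Matrix (Fin m) (Fin m) ℝ)
    (B₂ : Matrix (Fin m) (Fin m) ℝ)
    (A : Matrix (Fin k ⊕ Fin m) (Fin k ⊕ Fin m) ℝ) (B : Matrix (Fin k ⊕ Fin m) (Fin m) ℝ)
    (hA : A = Matrix.fromBlocks A₁₁ A₁₂ A₂₁ A₂₂) (hB : B = Matrix.fromRows 0 B₂)
    (hB₂ : B₂.det ≠ 0) (hstab : MAS.IsStabilizable A B)
    -- the gain `F = B₂⁻¹ V⁻¹ Σ V [K I]`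
    (V : Matrix (Fin m) (Fin m) ℝ) (hV : V.det ≠ 0)
    (σ : Fin m → ℝ) (hσ : ∀ j, 0 < σ j) (K : Matrix (Fin m) (Fin k) ℝ)
    (F : Matrix (Fin m) (Fin k ⊕ Fin m) ℝ)
    (hF : F = B₂⁻¹ * V⁻¹ * Matrix.diagonal σ * V * Matrix.fromCols K 1)
    -- `w = -F z` solves the LQR problem
    (Q : Matrix (Fin k ⊕ Fin m) (Fin k ⊕ Fin m) ℝ) (hQ : Q.PosSemidef)
    (R : Matrix (Fin m) (Fin m) ℝ) (hR : R.PosDef)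
    (hLQR : MAS.IsLQRSolution A B Q R F)
    -- the specified stable eigenvalues
    (s : Fin k → ℂ)
    (hs : MAS.eigenvalues (A₁₁ - A₁₂ * K) = (Finset.univ : Finset (Fin k)).val.map s)
    (hs_stable : ∀ j, (s j).re < 0) (hs_new : ∀ j, s j ∉ MAS.eigenvalues A₁₁) :
    -- `𝓜` is diagonalizable with distinct positive real eigenvalues
    (∀ (d : Fin N → ℝ) (a : Matrix (Fin N) (Fin N) ℝ),
      MAS.IsCoupling a → MAS.GershgorinSeparated d a →
      ∃ (p : Fin N → ℝ) (T : Matrix (Fin N) (Fin N) ℝ),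
        Function.Injective p ∧ (∀ i, 0 < p i) ∧ T.det ≠ 0 ∧
          T * MAS.couplingM d a * T⁻¹ = Matrix.diagonal p) ∧
    -- the eigenvalue distribution as all `d i → ∞`, the coupling weights staying bounded
    -- (in particular for a fixed coupling matrix)
    (∀ {ι : Type*} (l : Filter ι) (d : ι → Fin N → ℝ) (a : ι → Matrix (Fin N) (Fin N) ℝ) (C : ℝ),
      (∀ᶠ t in l, MAS.IsCoupling (a t) ∧ MAS.GershgorinSeparated (d t) (a t)) →
      (∀ᶠ t in l, ∀ i j, a t i j ≤ C) →
      (∀ i, Tendsto (fun t => d t i) l atTop) →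
      ∃ lam : ι → Fin N → Fin k ⊕ Fin m → ℂ,
        (∀ t, MAS.eigenvalues (MAS.systemMatrix A B F (MAS.couplingM (d t) (a t))) =
          (Finset.univ : Finset (Fin N × (Fin k ⊕ Fin m))).val.map fun q => lam t q.1 q.2) ∧
        (∀ i j, Tendsto (fun t => lam t i (Sum.inl j)) l (𝓝 (s j))) ∧
        ∀ i j,
          ((fun t => lam t i (Sum.inr j)) ~[l] fun t => ((-(d t i * σ j) : ℝ) : ℂ)) ∧
          ((fun t => lam t i (Sum.inr j) - ((-(d t i * σ j) : ℝ) : ℂ)) =O[l]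
            fun _ => (1 : ℝ))) := by
  have hdiag : ∀ (d : Fin N → ℝ) (a : Matrix (Fin N) (Fin N) ℝ),
      MAS.IsCoupling a → MAS.GershgorinSeparated d a →
      ∃ (p : Fin N → ℝ) (T : Matrix (Fin N) (Fin N) ℝ),
        Function.Injective p ∧ (∀ i, 0 < p i) ∧ T.det ≠ 0 ∧
          T * MAS.couplingM d a * T⁻¹ = Matrix.diagonal p ∧
          ∀ i, |p i - d i| ≤ MAS.rowSum a i + 1 := by
    intro d a ha h
    obtain ⟨p, hp, hpos, hroot, hpd⟩ := MAS.exists_isRoot_charpoly_couplingM ha h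
    obtain ⟨T, hT, hTM⟩ := MAS.exists_conj_eq_diagonal_of_injective _ p hp hroot
    exact ⟨p, T, hp, hpos, hT, hTM, hpd⟩
  refine ⟨fun d a ha h => ?_, fun {ι} l d a C hsep hbdd hd => ?_⟩
  · obtain ⟨p, T, hp, hpos, hT, hTM, -⟩ := hdiag d a ha h
    exact ⟨p, T, hp, hpos, hT, hTM⟩
  subst hA hB hF
  obtain ⟨μ, hμ, hμs, hμσ⟩ := MAS.exists_eigenvalues_highGain A₁₁ A₁₂ A₂₁ A₂₂ B₂ hB₂ V hV σ hσ K s hs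
  set A := Matrix.fromBlocks A₁₁ A₁₂ A₂₁ A₂₂
  set B : Matrix (Fin k ⊕ Fin m) (Fin m) ℝ := Matrix.fromRows 0 B₂
  set F := B₂⁻¹ * V⁻¹ * Matrix.diagonal σ * V * Matrix.fromCols K (1 : Matrix (Fin m) (Fin m) ℝ)
  -- The branches `μ` are fixed once as functions of the gain and evaluated at `p i`. For a
  -- non-separated `t` any labelling will do, with `p = 0`.
  have hex : ∀ t, ∃ (p : Fin N → ℝ) (lam : Fin N → Fin k ⊕ Fin m → ℂ),
      MAS.eigenvalues (MAS.systemMatrix A B F (MAS.couplingM (d t) (a t))) =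
        (Finset.univ : Finset (Fin N × (Fin k ⊕ Fin m))).val.map (fun q => lam q.1 q.2) ∧
      (MAS.IsCoupling (a t) ∧ MAS.GershgorinSeparated (d t) (a t) →
        (∀ i, lam i = μ (p i)) ∧ ∀ i, |p i - d t i| ≤ MAS.rowSum (a t) i + 1) := by
    intro t
    by_cases ht : MAS.IsCoupling (a t) ∧ MAS.GershgorinSeparated (d t) (a t)
    · obtain ⟨p, T, -, -, hT, hTM, hpd⟩ := hdiag _ _ ht.1 ht.2
      refine ⟨p, fun i => μ (p i), ?_, fun _ => ⟨fun _ => rfl, hpd⟩⟩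
      rw [MAS.eigenvalues_systemMatrix A B F _ T p hT hTM]
      have hsum : ∀ {β : Type} [Fintype β] (f : β → ℂ),
          (Finset.univ : Finset β).val.map f = ∑ b, {f b} := fun f => by
        rw [← Multiset.sum_map_singleton (Multiset.map f _), Multiset.map_map]
        rfl
      simp only [hμ, hsum, Fintype.sum_prod_type]
    · obtain ⟨f, hf⟩ := MAS.exists_map_univ_eq (α := Fin N × (Fin k ⊕ Fin m)) _
        (MAS.card_roots_charpoly
          ((MAS.systemMatrix A B F (MAS.couplingM (d t) (a t))).map Complex.ofReal))
      exact ⟨0, fun i j => f (i, j), hf, fun h => absurd h ht⟩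
  choose p lam hlam hlamp using hex
  have hpd : ∀ i, (fun t => p t i - d t i) =O[l] fun _ => (1 : ℝ) := by
    intro i
    refine IsBigO.of_bound (N * C + 1) ?_
    filter_upwards [hsep, hbdd] with t ht htC
    have h1 : MAS.rowSum (a t) i ≤ N * C := by
      simpa [MAS.rowSum] using Finset.sum_le_sum fun j (_ : j ∈ Finset.univ) => htC i j
    rw [norm_one, mul_one, Real.norm_eq_abs]
    exact ((hlamp t ht).2 i).trans (by linarith)
  have hp : ∀ i, Tendsto (fun t => p t i) l atTop := by
    intro i
    obtain ⟨c, hc⟩ := (hpd i).bound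
    refine tendsto_atTop_mono' l ?_ (tendsto_atTop_add_const_right l (-c) (hd i))
    filter_upwards [hc] with t ht
    rw [norm_one, mul_one, Real.norm_eq_abs] at ht
    linarith [(abs_le.1 ht).1]
  have hev : ∀ i, (fun t => μ (p t i)) =ᶠ[l] fun t => lam t i := fun i => by
    filter_upwards [hsep] with t ht
    exact ((hlamp t ht).1 i).symm
  refine ⟨lam, hlam, fun i j => ?_, fun i j => ?_⟩
  · refine ((hμs j).comp (hp i)).congr' ?_
    filter_upwards [hev i] with t ht
    exact congrFun ht _
  -- Here `λ + d σ = (λ + p σ) - (p - d) σ`, and both terms are bounded. Since `d σ → ∞`, the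
  -- bounded error also gives the asymptotic equivalence.
  · have hO : (fun t => lam t i (Sum.inr j) - ((-(d t i * σ j) : ℝ) : ℂ)) =O[l]
        fun _ => (1 : ℝ) := by
      have h1 : (fun t => ((p t i - d t i : ℝ) : ℂ) * (σ j : ℂ)) =O[l] fun _ => (1 : ℝ) := by
        simpa using (Complex.isBigO_ofReal_left.2 (hpd i)).mul
          (isBigO_const_const (σ j : ℂ) (one_ne_zero (α := ℝ)) l)
      refine (((hμσ j).comp_tendsto (hp i)).sub h1).congr' ?_ EventuallyEq.rfl
      filter_upwards [hev i] with t ht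
      simp only [Function.comp_apply, ← ht]
      push_cast
      ring
    refine ⟨hO.trans_isLittleO ?_, hO⟩
    rw [isLittleO_const_left]
    right
    simp only [Function.comp_def, Complex.norm_real, norm_neg]
    exact tendsto_norm_atTop_atTop.comp ((hd i).atTop_mul_const (hσ j))
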